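/- Let $B$ be a real separable Banach space with dual $B^*$, and let $\mu$ be a centered Gaussian measure on the Borel sets of $B$. For a probability measure $\nu$ on $B$ and $a\in B$ let $HD_{B^*}(a,\nu)=\inf_{t\in B^*}\nu(\{x\in B: t(x)\ge t(a)\})$ be the (Tukey) half space depth, and let $\Phi$ be the standard normal distribution function. Let $S:B^*\to B$, $Sf=\int_B x f(x)\,d\mu(x)$ (Bochner integral), and let $H_\mu$ be the Hilbert space obtained by completing the range of $S$ in the norm $\|\cdot\|_\mu$ given by the inner product $\langle Sf,Sg\rangle_\mu=\int_B fg\,d\mu$; it is viewed as a subset of $B$ through the (injective) continuous extension of the inclusion of the range of $S$ in $B$. Then: 1. if $\mu\neq\delta_0$, then $HD_{B^*}(a,\mu)=1-\Phi(\|a\|_\mu)$ for all $a\in H_\mu$; 2. $HD_{B^*}(a,\mu)=0$ for all $a\in B\setminus H_\mu$; 3. the set $\{a\in B: HD_{B^*}(a,\mu)=0\}$ is Borel, and its $\mu$-measure is $0$ if $H_\mu$ is finite dimensional and $1$ if $H_\mu$ is infinite dimensional; 4. suppose that $H_\mu$ is infinite dimensional, let $X_1,X_2,\dots$ be i.i.d.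 $B$-valued random vectors with law $\mu$ on a probability space $(\Omega,\mathcal F,P)$, and let $\mu_n=\frac1n\sum_{j=1}^n\delta_{X_j}$. Then for every $a\in H_\mu$, with $P$-probability one, $HD_{B^*}(a,\mu_n)=0$ for all $n\ge1$, whereas $HD_{B^*}(a,\mu)>0$; hence, with $P$-probability one, $HD_{B^*}(a,\mu_n)$ does not converge to $HD_{B^*}(a,\mu)$ as $n\to\infty$, i.e. consistency fails at every $a\in H_\mu$. -/

import Mathlib

open MeasureTheory ProbabilityTheory Filter Topology
open scoped ENNReal

noncomputable section

/-- The half space depth `inf_{t ∈ T} μ {x : t x ≥ t a}` of the point `a` with respect to a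
(non-empty) collection `T` of real functionals and a probability measure `μ`. -/
def halfSpaceDepth {B : Type*} [MeasurableSpace B] (T : Set (B → ℝ)) (a : B) (μ : Measure B) : ℝ :=
  ⨅ t : T, μ.real {x | (t : B → ℝ) a ≤ (t : B → ℝ) x}

/-- The topological dual `B*`, as a collection of real functionals on `B`. -/
def dualFunctionals (B : Type*) [NormedAddCommGroup B] [NormedSpace ℝ B] : Set (B → ℝ) :=
  Set.range fun f : StrongDual ℝ B => (f : B → ℝ)

/-- The Tukey half space depth `HD_{B*}(a, μ)`. -/
def tukeyDepth {B : Type*} [NormedAddCommGroup B] [NormedSpace ℝ B] [MeasurableSpace B]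
    (a : B) (μ : Measure B) : ℝ :=
  halfSpaceDepth (dualFunctionals B) a μ

/-- The empirical measure `(1 / n) ∑ δ_{X_j(ω)}` of the first `n` members of the sequence
`X 0, X 1, …` (a probability measure as soon as `n ≥ 1`). -/
def empiricalMeasure {Ω B : Type*} [MeasurableSpace B] (X : ℕ → Ω → B) (n : ℕ) (ω : Ω) :
    Measure B :=
  (n : ℝ≥0∞)⁻¹ • ∑ j ∈ Finset.range n, Measure.dirac (X j ω)

/-- The distribution function `Φ` of a centered Gaussian random variable with variance one. -/
def stdNormalCdf (x : ℝ) : ℝ := cdf (gaussianReal 0 1) x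

/-! ### The Hilbert space generating a Gaussian measure -/

namespace CameronMartin

variable {B : Type*} [NormedAddCommGroup B] [NormedSpace ℝ B] [CompleteSpace B]
  [SecondCountableTopology B] [MeasurableSpace B] [BorelSpace B]

theorem memLp_dual (μ : Measure B) [IsGaussian μ] (f : StrongDual ℝ B) :
    MemLp (fun x => f x) 2 μ :=
  IsGaussian.memLp_dual μ f 2 (by norm_num)

theorem integrable_smul (μ : Measure B) [IsGaussian μ] (f : StrongDual ℝ B) :
    Integrable (fun x => f x • x) μ :=
  memLp_one_iff_integrable.1
    (MemLp.smul (p := 2) (q := 2) (r := 1) (IsGaussian.memLp_two_id (μ := μ)) (memLp_dual μ f))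

theorem integrable_mul (μ : Measure B) [IsGaussian μ] (f g : StrongDual ℝ B) :
    Integrable (fun x => f x * g x) μ :=
  (memLp_dual μ f).integrable_mul (memLp_dual μ g)

/-- The linear map `S : B* → B`, `S f = ∫ x f(x) dμ(x)` (Bochner integral). -/
def S (μ : Measure B) [IsGaussian μ] : StrongDual ℝ B →ₗ[ℝ] B where
  toFun f := ∫ x, f x • x ∂μ
  map_add' f g := by
    simp only [FunLike.coe_add, Pi.add_apply, add_smul]
    exact integral_add (integrable_smul μ f) (integrable_smul μ g)
  map_smul' c f := by
    simp only [FunLike.coe_smul, Pi.smul_apply, smul_eq_mul, mul_smul, RingHom.id_apply]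
    exact integral_smul c _

theorem S_apply (μ : Measure B) [IsGaussian μ] (f : StrongDual ℝ B) :
    S μ f = ∫ x, f x • x ∂μ := rfl

theorem dual_S (μ : Measure B) [IsGaussian μ] (f g : StrongDual ℝ B) :
    g (S μ f) = ∫ x, f x * g x ∂μ := by
  rw [S_apply, ← g.integral_comp_comm (integrable_smul μ f)]
  simp

/-- The range of `S`, to be normed by `‖S f‖_μ = (∫ f² dμ)^{1/2}` and not by the norm of `B`. -/
def RangeS (μ : Measure B) [IsGaussian μ] : Type _ := LinearMap.range (S μ)

instance (μ : Measure B) [IsGaussian μ] : AddCommGroup (RangeS μ) :=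
  inferInstanceAs (AddCommGroup (LinearMap.range (S μ)))

instance (μ : Measure B) [IsGaussian μ] : Module ℝ (RangeS μ) :=
  inferInstanceAs (Module ℝ (LinearMap.range (S μ)))

/-- The element `S f` of the range of `S`. -/
def mk (μ : Measure B) [IsGaussian μ] : StrongDual ℝ B →ₗ[ℝ] RangeS μ := (S μ).rangeRestrict

/-- The inclusion of the range of `S` in `B`, as a linear map. -/
def inclLin (μ : Measure B) [IsGaussian μ] : RangeS μ →ₗ[ℝ] B := (LinearMap.range (S μ)).subtype

theorem inclLin_mk (μ : Measure B) [IsGaussian μ] (f : StrongDual ℝ B) :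
    inclLin μ (mk μ f) = S μ f := rfl

theorem mk_surjective (μ : Measure B) [IsGaussian μ] : Function.Surjective (mk μ) :=
  (S μ).surjective_rangeRestrict

/-- A functional `f` with `S f = x`. -/
def pre (μ : Measure B) [IsGaussian μ] (x : RangeS μ) : StrongDual ℝ B :=
  (mk_surjective μ x).choose

theorem mk_pre (μ : Measure B) [IsGaussian μ] (x : RangeS μ) : mk μ (pre μ x) = x :=
  (mk_surjective μ x).choose_spec

theorem integral_congr_S (μ : Measure B) [IsGaussian μ] {f f' g g' : StrongDual ℝ B}
    (hf : mk μ f = mk μ f') (hg : mk μ g = mk μ g') :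
    ∫ x, f x * g x ∂μ = ∫ x, f' x * g' x ∂μ := by
  have hf' : S μ f = S μ f' := congrArg (inclLin μ) hf
  have hg' : S μ g = S μ g' := congrArg (inclLin μ) hg
  rw [← dual_S, hf', dual_S]
  simp_rw [mul_comm (f' _)]
  rw [← dual_S, hg', dual_S]

/-- The inner product `⟨S f, S g⟩_μ = ∫ f g dμ` on the range of `S`; it does not depend on the
chosen `f` and `g`, see `inner_mk`. -/
instance core (μ : Measure B) [IsGaussian μ] : InnerProductSpace.Core ℝ (RangeS μ) where
  inner x y := ∫ z, pre μ x z * pre μ y z ∂μ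
  conj_inner_symm x y := by simp [mul_comm]
  re_inner_nonneg x := integral_nonneg fun z => mul_self_nonneg _
  add_left x y z := by
    rw [integral_congr_S μ (f' := pre μ x + pre μ y) (g' := pre μ z) (by simp [mk_pre]) rfl,
      ← integral_add (integrable_mul μ _ _) (integrable_mul μ _ _)]
    simp [add_mul]
  smul_left x y r := by
    rw [integral_congr_S μ (f' := r • pre μ x) (g' := pre μ y) (by simp [mk_pre]) rfl]
    simp [mul_assoc, integral_const_mul]
  definite x hx := by
    have h0 : (fun z => pre μ x z * pre μ x z) =ᵐ[μ] 0 :=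
      (integral_eq_zero_iff_of_nonneg (fun z => mul_self_nonneg _) (integrable_mul μ _ _)).1 hx
    have h1 : S μ (pre μ x) = 0 := by
      rw [S_apply]
      refine integral_eq_zero_of_ae ?_
      filter_upwards [h0] with z hz
      have : pre μ x z = 0 := mul_self_eq_zero.1 hz
      simp [this]
    rw [← mk_pre μ x]
    exact Subtype.ext h1

instance (μ : Measure B) [IsGaussian μ] : NormedAddCommGroup (RangeS μ) :=
  (core μ).toNormedAddCommGroup

instance (μ : Measure B) [IsGaussian μ] : InnerProductSpace ℝ (RangeS μ) :=
  InnerProductSpace.ofCore (core μ).toCore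

theorem inner_mk (μ : Measure B) [IsGaussian μ] (f g : StrongDual ℝ B) :
    inner ℝ (mk μ f) (mk μ g) = ∫ x, f x * g x ∂μ :=
  integral_congr_S μ (mk_pre μ _) (mk_pre μ _)

theorem norm_mk_sq (μ : Measure B) [IsGaussian μ] (f : StrongDual ℝ B) :
    ‖mk μ f‖ ^ 2 = ∫ x, f x ^ 2 ∂μ := by
  rw [← real_inner_self_eq_norm_sq, inner_mk]
  simp [sq]

theorem dual_inclLin (μ : Measure B) [IsGaussian μ] (f : StrongDual ℝ B) (x : RangeS μ) :
    f (inclLin μ x) = inner ℝ (mk μ f) x := by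
  rw [← mk_pre μ x, inclLin_mk, dual_S, inner_mk]
  simp [mul_comm]

theorem exists_bound (μ : Measure B) [IsGaussian μ] :
    ∃ C : ℝ, ∀ x : RangeS μ, ‖inclLin μ x‖ ≤ C * ‖x‖ := by
  have hint : Integrable (fun x : B => ‖x‖ ^ 2) μ :=
    (IsGaussian.memLp_two_id (μ := μ)).integrable_norm_pow (by norm_num)
  refine ⟨√(∫ x, ‖x‖ ^ 2 ∂μ), fun x => NormedSpace.norm_le_dual_bound ℝ _ (by positivity) ?_⟩
  intro f
  rw [dual_inclLin]
  have h1 : ‖mk μ f‖ ≤ ‖f‖ * √(∫ x, ‖x‖ ^ 2 ∂μ) := by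
    refine le_of_sq_le_sq ?_ (by positivity)
    rw [norm_mk_sq, mul_pow, Real.sq_sqrt (integral_nonneg fun x => by positivity),
      ← integral_const_mul]
    refine integral_mono_of_nonneg (.of_forall fun x => sq_nonneg _) (hint.const_mul _)
      (.of_forall fun x => ?_)
    have := f.le_opNorm x
    simp only
    rw [← mul_pow, ← sq_abs]
    gcongr
    exact this
  calc ‖inner ℝ (mk μ f) x‖ ≤ ‖mk μ f‖ * ‖x‖ := norm_inner_le_norm _ _
    _ ≤ (‖f‖ * √(∫ x, ‖x‖ ^ 2 ∂μ)) * ‖x‖ := by gcongr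
    _ = _ := by ring

/-- The inclusion of the range of `S` in `B` is continuous for `‖·‖_μ`. -/
def incl (μ : Measure B) [IsGaussian μ] : RangeS μ →L[ℝ] B :=
  (inclLin μ).mkContinuousOfExistsBound (exists_bound μ)

end CameronMartin

/-- The Hilbert space `H_μ` generating the centered Gaussian measure `μ`: the completion of the
range of `S` for the inner product `⟨S f, S g⟩_μ = ∫ f g dμ`. Its norm is `‖·‖_μ`. -/
abbrev CameronMartinSpace {B : Type*} [NormedAddCommGroup B] [NormedSpace ℝ B] [CompleteSpace B]
    [SecondCountableTopology B] [MeasurableSpace B] [BorelSpace B]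
    (μ : Measure B) [IsGaussian μ] : Type _ :=
  UniformSpace.Completion (CameronMartin.RangeS μ)

namespace CameronMartinSpace

variable {B : Type*} [NormedAddCommGroup B] [NormedSpace ℝ B] [CompleteSpace B]
  [SecondCountableTopology B] [MeasurableSpace B] [BorelSpace B]

/-- The continuous extension `H_μ → B` of the inclusion of the range of `S`. It is injective, and
`H_μ` is viewed as a subset of `B` through it. -/
def toBanach (μ : Measure B) [IsGaussian μ] : CameronMartinSpace μ →L[ℝ] B :=
  (CameronMartin.incl μ).extend UniformSpace.Completion.toComplL

theorem toBanach_coe (μ : Measure B) [IsGaussian μ] (x : CameronMartin.RangeS μ) :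
    toBanach μ (x : CameronMartinSpace μ) = CameronMartin.inclLin μ x :=
  ContinuousLinearMap.extend_eq (e := UniformSpace.Completion.toComplL (𝕜 := ℝ))
    (CameronMartin.incl μ) UniformSpace.Completion.denseRange_coe
    (UniformSpace.Completion.isUniformInducing_coe _) x

theorem dual_toBanach (μ : Measure B) [IsGaussian μ] (f : StrongDual ℝ B)
    (h : CameronMartinSpace μ) :
    f (toBanach μ h) = inner ℝ (CameronMartin.mk μ f : CameronMartinSpace μ) h := by
  induction h using UniformSpace.Completion.induction_on with
  | hp => exact isClosed_eq (by fun_prop) (by fun_prop)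
  | ih x => rw [toBanach_coe, CameronMartin.dual_inclLin, UniformSpace.Completion.inner_coe]

theorem toBanach_injective (μ : Measure B) [IsGaussian μ] :
    Function.Injective (toBanach μ) := by
  rw [injective_iff_map_eq_zero]
  intro h hh
  have hd := UniformSpace.Completion.denseRange_coe (α := CameronMartin.RangeS μ)
  refine hd.eq_zero_of_inner_right ℝ fun x => ?_
  obtain ⟨f, rfl⟩ := CameronMartin.mk_surjective μ x
  rw [← dual_toBanach, hh, map_zero]

end CameronMartinSpace

end

/-!
A functional `f ∈ B*` has law `N(0, ‖S f‖_μ²)` under `μ`, so `μ {f ≥ f a}` is `1 - Φ` of the ratio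
`f a / ‖S f‖_μ`, and the depth of `a` is governed by the supremum of this ratio over `f`. For
`a ∈ H_μ` the ratio is `⟨S f, a⟩_μ / ‖S f‖_μ`, whose supremum is `‖a‖_μ` by Cauchy–Schwarz and the
density of the range of `S`; by Riesz representation, the supremum is infinite for `a ∉ H_μ`.

If `dim H_μ = ∞`, functionals `f₁, …, fₙ` with `S f₁, …, S fₙ` orthonormal are independent standard
normal variables under `μ`, and all of them are at most `r` in absolute value on the ball of radius
`r` of `H_μ`; letting `n → ∞`, each ball of `H_μ` is `μ`-null. Moreover every finite-dimensional
subspace of `B` lies in a closed hyperplane all of whose translates are `μ`-null; hence, for every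
`b`, the vectors `X₁ - b, …, Xₙ - b` are almost surely linearly independent, and some functional
takes the value `-1` on all of them: it describes a half space containing `b` and none of the `X_j`.
-/

section StdNormal

theorem continuous_cdf (ν : Measure ℝ) [IsProbabilityMeasure ν] [NullSingletonClass ν] :
    Continuous (cdf ν) := by
  refine continuous_iff_continuousAt.2 fun x => continuousAt_iff_continuous_left'_right'.2 ⟨?_, ?_⟩
  · rw [(monotone_cdf ν).continuousWithinAt_Iio_iff_leftLim_eq]
    have hjump := (cdf ν).measure_singleton x
    rw [measure_cdf, measure_singleton, eq_comm, ENNReal.ofReal_eq_zero, sub_nonpos] at hjump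
    exact ((monotone_cdf ν).leftLim_le le_rfl).antisymm hjump
  · exact ((cdf ν).right_continuous x).mono Set.Ioi_subset_Ici_self

theorem measureReal_Ici_eq_one_sub_cdf (ν : Measure ℝ) [IsProbabilityMeasure ν]
    [NullSingletonClass ν] (x : ℝ) : ν.real (Set.Ici x) = 1 - cdf ν x := by
  rw [cdf_eq_real, ← probReal_compl_eq_one_sub measurableSet_Iic, Set.compl_Iic]
  exact measureReal_congr Ioi_ae_eq_Ici.symm

theorem continuous_stdNormalCdf : Continuous stdNormalCdf :=
  have := nullSingletonClass_gaussianReal (μ := 0) one_ne_zero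
  continuous_cdf _

theorem tendsto_stdNormalCdf_atTop : Tendsto stdNormalCdf atTop (𝓝 1) := tendsto_cdf_atTop _

theorem gaussianReal_real_Ici (x : ℝ) :
    (gaussianReal 0 1).real (Set.Ici x) = 1 - stdNormalCdf x :=
  have := nullSingletonClass_gaussianReal (μ := 0) one_ne_zero
  measureReal_Ici_eq_one_sub_cdf _ x

theorem stdNormalCdf_lt_one (x : ℝ) : stdNormalCdf x < 1 := by
  rw [← sub_pos, ← gaussianReal_real_Ici]
  refine measureReal_nonneg.lt_of_ne' fun h => ?_
  have := gaussianReal_absolutelyContinuous' 0 one_ne_zero ((measureReal_eq_zero_iff).1 h)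
  simp at this

theorem gaussianReal_Icc_lt_one (x y : ℝ) : gaussianReal 0 1 (Set.Icc x y) < 1 := by
  refine (measure_mono Set.Icc_subset_Iic_self).trans_lt ?_
  rw [← ofReal_cdf, ← ENNReal.ofReal_one, ENNReal.ofReal_lt_ofReal_iff one_pos]
  exact stdNormalCdf_lt_one y

end StdNormal

section HahnBanach

theorem exists_strongDual_eq_zero_on_of_notMem {𝕜 E : Type*} [RCLike 𝕜] [NormedAddCommGroup E]
    [NormedSpace 𝕜 E] {V : Submodule 𝕜 E} (hV : IsClosed (V : Set E)) {x : E} (hx : x ∉ V) :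
    ∃ f : StrongDual 𝕜 E, (∀ y ∈ V, f y = 0) ∧ f x ≠ 0 := by
  obtain ⟨g, hg⟩ := SeparatingDual.exists_ne_zero (R := 𝕜) (x := V.mkQ x) (by simpa using hx)
  exact ⟨g.comp V.mkQL, fun y hy => by simp [(Submodule.Quotient.mk_eq_zero V).2 hy], hg⟩

theorem exists_strongDual_apply_eq_of_linearIndependent {𝕜 E ι : Type*} [Field 𝕜]
    [TopologicalSpace 𝕜] [IsTopologicalRing 𝕜] [AddCommGroup E] [TopologicalSpace E]
    [Module 𝕜 E] [SeparatingDual 𝕜 E] [Finite ι] {v : ι → E}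
    (hv : LinearIndependent 𝕜 v) (c : ι → 𝕜) :
    ∃ f : StrongDual 𝕜 E, ∀ i, f (v i) = c i := by
  have := Fintype.ofFinite ι
  obtain ⟨f, hf⟩ := SeparatingDual.dualMap_surjective_iff.2
    (hv.fintypeLinearCombination_injective) (Fintype.linearCombination 𝕜 c)
  classical
  exact ⟨f, fun i => by simpa using LinearMap.congr_fun hf (Pi.single i 1)⟩

theorem ae_mem_of_forall_strongDual_ae_eq_zero {𝕜 E : Type*} [RCLike 𝕜] [NormedAddCommGroup E]
    [NormedSpace 𝕜 E] [SecondCountableTopology E] [MeasurableSpace E] {μ : Measure E}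
    {V : Submodule 𝕜 E} (hV : IsClosed (V : Set E))
    (h : ∀ f : StrongDual 𝕜 E, (∀ y ∈ V, f y = 0) → ∀ᵐ x ∂μ, f x = 0) : ∀ᵐ x ∂μ, x ∈ V := by
  refine measure_null_of_locally_null _ fun x hx => ?_
  obtain ⟨f, hfV, hfx⟩ := exists_strongDual_eq_zero_on_of_notMem hV hx
  exact ⟨{y | f y ≠ 0}, mem_nhdsWithin_of_mem_nhds ((isOpen_ne_fun f.continuous
    continuous_const).mem_nhds hfx), h f hfV⟩

end HahnBanach

theorem exists_orthonormal_fin_of_not_finiteDimensional {𝕜 E : Type*} [RCLike 𝕜]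
    [NormedAddCommGroup E] [InnerProductSpace 𝕜 E] (h : ¬ FiniteDimensional 𝕜 E) (n : ℕ) :
    ∃ v : Fin n → E, Orthonormal 𝕜 v := by
  have hrank : (n : Cardinal) ≤ Module.rank 𝕜 E :=
    (Cardinal.natCast_lt_aleph0.le).trans (not_lt.1 (Module.rank_lt_aleph0_iff.not.2 h))
  obtain ⟨v, hv⟩ := exists_linearIndependent_of_le_rank hrank
  exact ⟨_, InnerProductSpace.gramSchmidtNormed_orthonormal hv⟩

section LinearIndependence

variable {𝕜 E Ω : Type*} [NontriviallyNormedField 𝕜] [CompleteSpace 𝕜] [NormedAddCommGroup E]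
  [NormedSpace 𝕜 E] [SecondCountableTopology E] [MeasurableSpace E] [BorelSpace E]
  [MeasurableSpace Ω] {P : Measure Ω} [IsProbabilityMeasure P] {n : ℕ}

theorem ae_linearIndependent_finCons_of_indepFun {X : Ω → E} {Y : Ω → Fin n → E}
    (hX : Measurable X) (hY : Measurable Y) (hind : IndepFun Y X P)
    (hnull : ∀ V : Submodule 𝕜 E, FiniteDimensional 𝕜 V → ∀ᵐ ω ∂P, X ω ∉ V)
    (hYind : ∀ᵐ ω ∂P, LinearIndependent 𝕜 (Y ω)) :
    ∀ᵐ ω ∂P, LinearIndependent 𝕜 (Fin.cons (X ω) (Y ω) : Fin (n + 1) → E) := by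
  have hmeas (m : ℕ) : MeasurableSet {v : Fin m → E | LinearIndependent 𝕜 v} :=
    isOpen_setOfPred_linearIndependent.measurableSet
  have hcons : Measurable fun p : (Fin n → E) × E => (Fin.cons p.2 p.1 : Fin (n + 1) → E) :=
    Continuous.measurable (by fun_prop)
  have : IsProbabilityMeasure (P.map Y) := Measure.isProbabilityMeasure_map hY.aemeasurable
  have : IsProbabilityMeasure (P.map X) := Measure.isProbabilityMeasure_map hX.aemeasurable
  have hprod : ∀ᵐ p ∂(P.map Y).prod (P.map X),
      LinearIndependent 𝕜 (Fin.cons p.2 p.1 : Fin (n + 1) → E) := by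
    refine (Measure.ae_prod_iff_ae_ae (hcons (hmeas _))).2 ?_
    filter_upwards [(ae_map_iff hY.aemeasurable (hmeas n)).2 hYind] with y hy
    have hspan : FiniteDimensional 𝕜 (Submodule.span 𝕜 (Set.range y)) :=
      FiniteDimensional.span_of_finite 𝕜 (Set.finite_range y)
    refine (ae_map_iff hX.aemeasurable (measurable_prodMk_left (hcons (hmeas _)))).2 ?_
    exact (hnull _ hspan).mono fun ω hω => linearIndependent_finCons.2 ⟨hy, hω⟩
  rw [← (indepFun_iff_map_prod_eq_prod_map_map hY.aemeasurable hX.aemeasurable).1 hind] at hprod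
  exact ae_of_ae_map (hY.prodMk hX).aemeasurable hprod

theorem ae_linearIndependent_of_iIndepFun {Y : Fin n → Ω → E} (hY : ∀ i, Measurable (Y i))
    (hind : iIndepFun Y P)
    (hnull : ∀ i, ∀ V : Submodule 𝕜 E, FiniteDimensional 𝕜 V → ∀ᵐ ω ∂P, Y i ω ∉ V) :
    ∀ᵐ ω ∂P, LinearIndependent 𝕜 fun i => Y i ω := by
  induction n with
  | zero => exact .of_forall fun ω => linearIndependent_empty_type
  | succ n ih =>
    have htail := ih (fun i => hY i.succ) (hind.precomp (Fin.succ_injective n))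
      fun i => hnull i.succ
    have hrest : Measurable fun (y : Finset.univ.erase (0 : Fin (n + 1)) → E) (i : Fin n) =>
        y ⟨i.succ, by simp⟩ := by fun_prop
    have hfirst : Measurable fun y : ({0} : Finset (Fin (n + 1))) → E => y ⟨0, by simp⟩ := by
      fun_prop
    have hindep : IndepFun (fun ω (i : Fin n) => Y i.succ ω) (Y 0) P :=
      (hind.indepFun_finset (Finset.univ.erase 0) {0} (by simp) hY).comp hrest hfirst
    filter_upwards [ae_linearIndependent_finCons_of_indepFun (hY 0)
      (measurable_pi_lambda _ fun i => hY i.succ) hindep (hnull 0) htail] with ω hω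
    convert hω using 1
    exact (Fin.cons_self_tail fun i => Y i ω).symm

end LinearIndependence

section Depth

variable {B : Type*} [NormedAddCommGroup B] [NormedSpace ℝ B] [MeasurableSpace B]

theorem tukeyDepth_le_measureReal (f : StrongDual ℝ B) (a : B) (μ : Measure B) :
    tukeyDepth a μ ≤ μ.real {x | f a ≤ f x} :=
  ciInf_le (f := fun t : dualFunctionals B => μ.real {x | (t : B → ℝ) a ≤ (t : B → ℝ) x})
    ⟨0, Set.forall_mem_range.2 fun _ => measureReal_nonneg⟩ ⟨f, f, rfl⟩

theorem le_tukeyDepth {c : ℝ} {a : B} {μ : Measure B}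
    (h : ∀ f : StrongDual ℝ B, c ≤ μ.real {x | f a ≤ f x}) : c ≤ tukeyDepth a μ :=
  have : Nonempty (dualFunctionals B) := ⟨⟨_, 0, rfl⟩⟩
  le_ciInf (by rintro ⟨_, f, rfl⟩; exact h f)

theorem tukeyDepth_nonneg (a : B) (μ : Measure B) : 0 ≤ tukeyDepth a μ :=
  le_tukeyDepth fun _ => measureReal_nonneg

theorem tukeyDepth_empiricalMeasure_eq_zero [OpensMeasurableSpace B] {Ω : Type*} {X : ℕ → Ω → B}
    {n : ℕ} {ω : Ω} {b : B} (hind : LinearIndependent ℝ fun i : Fin n => X i ω - b) :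
    tukeyDepth b (empiricalMeasure X n ω) = 0 := by
  obtain ⟨f, hf⟩ := exists_strongDual_apply_eq_of_linearIndependent hind fun _ => -1
  have hlt (j : ℕ) (hj : j < n) : f (X j ω) < f b := by
    have := hf ⟨j, hj⟩
    rw [map_sub] at this
    linarith
  refine ((tukeyDepth_le_measureReal f _ _).trans_eq ?_).antisymm (tukeyDepth_nonneg _ _)
  have hmeas : MeasurableSet {x | f b ≤ f x} :=
    (isClosed_le continuous_const f.continuous).measurableSet
  rw [empiricalMeasure, measureReal_def, Measure.smul_apply, Measure.finsetSum_apply,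
    Finset.sum_eq_zero, smul_zero, ENNReal.toReal_zero]
  intro j hj
  rw [Measure.dirac_apply' _ hmeas, Set.indicator_of_notMem]
  exact (hlt j (Finset.mem_range.1 hj)).not_ge

end Depth

section Gaussian

variable {B : Type*} [NormedAddCommGroup B] [NormedSpace ℝ B] [CompleteSpace B]
  [SecondCountableTopology B] [MeasurableSpace B] [BorelSpace B]
  {μ : Measure B} [IsGaussian μ]

namespace CameronMartin

theorem ae_eq_zero_of_mk_eq_zero {f : StrongDual ℝ B} (hf : mk μ f = 0) : ∀ᵐ x ∂μ, f x = 0 := by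
  have h := norm_mk_sq μ f
  rw [hf, norm_zero, zero_pow two_ne_zero, eq_comm,
    integral_eq_zero_iff_of_nonneg (fun x => sq_nonneg _) (memLp_dual μ f).integrable_sq] at h
  exact h.mono fun x hx => pow_eq_zero_iff two_ne_zero |>.1 hx

theorem covariance_dual (hμ : ∫ x, x ∂μ = 0) (f g : StrongDual ℝ B) :
    cov[f, g; μ] = inner ℝ (mk μ f) (mk μ g) := by
  rw [covariance_eq_sub (memLp_dual μ f) (memLp_dual μ g), IsGaussian.integral_dual, hμ, map_zero,
    zero_mul, sub_zero, inner_mk]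
  rfl

theorem variance_dual (hμ : ∫ x, x ∂μ = 0) (f : StrongDual ℝ B) :
    Var[f; μ] = ‖mk μ f‖ ^ 2 := by
  rw [← covariance_self (by fun_prop), covariance_dual hμ, real_inner_self_eq_norm_sq]

theorem map_dual (hμ : ∫ x, x ∂μ = 0) (f : StrongDual ℝ B) :
    μ.map f = (gaussianReal 0 1).map (‖mk μ f‖ * ·) := by
  rw [IsGaussian.map_eq_gaussianReal f, IsGaussian.integral_dual, hμ, map_zero, variance_dual hμ,
    gaussianReal_map_const_mul, mul_zero, mul_one, Real.toNNReal_of_nonneg (sq_nonneg _)]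

theorem measureReal_halfSpace (hμ : ∫ x, x ∂μ = 0) (f : StrongDual ℝ B) (c : ℝ) :
    μ.real {x | c ≤ f x} = (gaussianReal 0 1).real {z | c ≤ ‖mk μ f‖ * z} := by
  have h := congrArg (·.real (Set.Ici c)) (map_dual hμ f)
  rwa [map_measureReal_apply (by fun_prop) measurableSet_Ici,
    map_measureReal_apply (by fun_prop) measurableSet_Ici] at h

theorem measureReal_halfSpace_le (hμ : ∫ x, x ∂μ = 0) {f : StrongDual ℝ B} {r c : ℝ}
    (h : r * ‖mk μ f‖ < c) : μ.real {x | c ≤ f x} ≤ 1 - stdNormalCdf r := by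
  rw [measureReal_halfSpace hμ, ← gaussianReal_real_Ici]
  refine measureReal_mono fun z (hz : c ≤ ‖mk μ f‖ * z) => ?_
  exact (lt_of_mul_lt_mul_left (by linarith) (norm_nonneg (mk μ f))).le

theorem le_measureReal_halfSpace (hμ : ∫ x, x ∂μ = 0) {f : StrongDual ℝ B} {r c : ℝ}
    (h : c ≤ r * ‖mk μ f‖) : 1 - stdNormalCdf r ≤ μ.real {x | c ≤ f x} := by
  rw [measureReal_halfSpace hμ, ← gaussianReal_real_Ici]
  refine measureReal_mono fun z (hz : r ≤ z) => ?_
  exact h.trans (by rw [mul_comm]; gcongr)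

theorem ae_dual_ne (hμ : ∫ x, x ∂μ = 0) {f : StrongDual ℝ B} (hf : mk μ f ≠ 0) (c : ℝ) :
    ∀ᵐ x ∂μ, f x ≠ c := by
  have := nullSingletonClass_gaussianReal (μ := 0) one_ne_zero
  have hz : ∀ᵐ z ∂gaussianReal 0 1, ‖mk μ f‖ * z ≠ c := by
    filter_upwards [Measure.ae_ne (gaussianReal 0 1) (c / ‖mk μ f‖)] with z hz hzc
    exact hz (eq_div_of_mul_eq (norm_ne_zero_iff.2 hf) (by rwa [mul_comm]))
  refine ae_of_ae_map (p := (· ≠ c)) (by fun_prop) ?_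
  rw [map_dual hμ]
  exact (ae_map_iff (by fun_prop) (measurableSet_singleton c).compl).2 hz

theorem measure_forall_dual_mem (hμ : ∫ x, x ∂μ = 0) {n : ℕ} {f : Fin n → StrongDual ℝ B}
    (hf : Orthonormal ℝ fun i => mk μ (f i)) {s : Set ℝ} (hs : MeasurableSet s) :
    μ {x | ∀ i, f i x ∈ s} = gaussianReal 0 1 s ^ n := by
  have hind : iIndepFun (fun i x => f i x) μ :=
    HasGaussianLaw.iIndepFun_of_covariance_eq_zero
      ((IsGaussian.hasGaussianLaw_id (μ := μ)).map_fun (ContinuousLinearMap.pi f))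
      fun i j hij => (covariance_dual hμ _ _).trans (hf.2 hij)
  have hmarginal (i : Fin n) : μ (f i ⁻¹' s) = gaussianReal 0 1 s := by
    rw [← Measure.map_apply (by fun_prop) hs, map_dual hμ, hf.1 i]
    simp
  have hprod := hind.measure_inter_preimage_eq_mul Finset.univ (sets := fun _ => s) fun _ _ => hs
  simp only [hmarginal, Finset.prod_const, Finset.card_univ, Fintype.card_fin] at hprod
  rw [← hprod]
  congr 1
  ext x
  simp

end CameronMartin

namespace CameronMartinSpace

open CameronMartin

theorem denseRange_mk : DenseRange fun f : StrongDual ℝ B => (mk μ f : CameronMartinSpace μ) :=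
  UniformSpace.Completion.denseRange_coe.comp (mk_surjective μ).denseRange
    (UniformSpace.Completion.continuous_coe _)

theorem dual_toBanach_le (f : StrongDual ℝ B) (h : CameronMartinSpace μ) :
    f (toBanach μ h) ≤ ‖h‖ * ‖mk μ f‖ := by
  rw [dual_toBanach, mul_comm, ← UniformSpace.Completion.norm_coe (mk μ f)]
  exact real_inner_le_norm _ _

theorem toBanach_image_closedBall {r : ℝ} (hr : 0 ≤ r) :
    toBanach μ '' Metric.closedBall 0 r = {a | ∀ f : StrongDual ℝ B, f a ≤ r * ‖mk μ f‖} := by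
  refine Set.Subset.antisymm ?_ fun a ha => ?_
  · rintro _ ⟨h, hh, rfl⟩ f
    exact (dual_toBanach_le f h).trans (by gcongr; exact mem_closedBall_zero_iff.1 hh)
  let e : StrongDual ℝ B →ₗ[ℝ] CameronMartinSpace μ :=
    UniformSpace.Completion.toComplL.toLinearMap ∘ₗ mk μ
  let evalAt : StrongDual ℝ B →ₗ[ℝ] ℝ := (ContinuousLinearMap.apply ℝ ℝ a).toLinearMap
  have hbound (f : StrongDual ℝ B) : ‖evalAt f‖ ≤ r * ‖e f‖ := by
    have hneg := ha (-f)
    rw [map_neg, norm_neg] at hneg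
    exact (abs_le'.2 ⟨ha f, hneg⟩).trans_eq (by simp [e])
  let h := (InnerProductSpace.toDual ℝ (CameronMartinSpace μ)).symm (evalAt.extendOfNorm e)
  refine ⟨h, mem_closedBall_zero_iff.2 ?_, ?_⟩
  · rw [LinearIsometryEquiv.norm_map]
    exact LinearMap.opNorm_extendOfNorm_le denseRange_mk hr hbound
  · refine (SeparatingDual.eq_iff_forall_dual_eq (R := ℝ)).2 fun f => ?_
    rw [dual_toBanach, real_inner_comm, InnerProductSpace.toDual_symm_apply]
    exact LinearMap.extendOfNorm_eq denseRange_mk ⟨r, hbound⟩ f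

theorem range_toBanach : Set.range (toBanach μ) =
    ⋃ n : ℕ, {a | ∀ f : StrongDual ℝ B, f a ≤ n * ‖mk μ f‖} := by
  simp_rw [← toBanach_image_closedBall (Nat.cast_nonneg _), ← Set.image_iUnion,
    Metric.iUnion_closedBall_nat, Set.image_univ]

theorem measurableSet_range_toBanach : MeasurableSet (Set.range (toBanach μ)) := by
  rw [range_toBanach]
  refine .iUnion fun n => IsClosed.measurableSet ?_
  simp only [Set.ofPred_forall]
  exact isClosed_iInter fun f => isClosed_le (by fun_prop) (by fun_prop)

theorem ae_mem_range_toBanach [FiniteDimensional ℝ (CameronMartinSpace μ)] :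
    ∀ᵐ a ∂μ, a ∈ Set.range (toBanach μ) := by
  refine ae_mem_of_forall_strongDual_ae_eq_zero (V := (toBanach μ).toLinearMap.range)
    (Submodule.closed_of_finiteDimensional _) fun f hf => ae_eq_zero_of_mk_eq_zero ?_
  rw [← norm_eq_zero, ← sq_eq_zero_iff, ← real_inner_self_eq_norm_sq, ← dual_inclLin,
    ← toBanach_coe]
  exact hf _ ⟨_, rfl⟩

theorem exists_strongDual_eq_zero_on_mk_ne_zero
    (hinf : ¬ FiniteDimensional ℝ (CameronMartinSpace μ))
    (V : Submodule ℝ B) [FiniteDimensional ℝ V] :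
    ∃ f : StrongDual ℝ B, (∀ x ∈ V, f x = 0) ∧ mk μ f ≠ 0 := by
  by_contra! hV
  have hmem (h : CameronMartinSpace μ) : toBanach μ h ∈ V := by
    by_contra hh
    obtain ⟨f, hfV, hfh⟩ :=
      exists_strongDual_eq_zero_on_of_notMem V.closed_of_finiteDimensional hh
    exact hfh (by rw [dual_toBanach, hV f hfV, UniformSpace.Completion.coe_zero, inner_zero_left])
  exact hinf (FiniteDimensional.of_injective ((toBanach μ).toLinearMap.codRestrict V hmem)
    fun h h' hh => toBanach_injective μ (congrArg Subtype.val hh))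

theorem not_finiteDimensional_rangeS (hinf : ¬ FiniteDimensional ℝ (CameronMartinSpace μ)) :
    ¬ FiniteDimensional ℝ (RangeS μ) := by
  intro hfin
  obtain ⟨f, hf, hf0⟩ := exists_strongDual_eq_zero_on_mk_ne_zero hinf (inclLin μ).range
  refine hf0 (inner_self_eq_zero (𝕜 := ℝ).1 ?_)
  rw [← dual_inclLin]
  exact hf _ ⟨_, rfl⟩

theorem measure_range_toBanach_eq_zero (hμ : ∫ x, x ∂μ = 0)
    (hinf : ¬ FiniteDimensional ℝ (CameronMartinSpace μ)) : μ (Set.range (toBanach μ)) = 0 := by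
  rw [range_toBanach, measure_iUnion_null_iff]
  intro c
  refine le_antisymm (ge_of_tendsto' (ENNReal.tendsto_pow_atTop_nhds_zero_of_lt_one
    (gaussianReal_Icc_lt_one (-c) c)) fun n => ?_) bot_le
  obtain ⟨v, hv⟩ :=
    exists_orthonormal_fin_of_not_finiteDimensional (not_finiteDimensional_rangeS hinf) n
  obtain ⟨f, rfl⟩ : ∃ f : Fin n → StrongDual ℝ B, (fun i => mk μ (f i)) = v :=
    ⟨fun i => pre μ (v i), funext fun i => mk_pre μ (v i)⟩
  rw [← measure_forall_dual_mem hμ hv measurableSet_Icc]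
  refine measure_mono fun a ha i => ?_
  have hpos := ha (f i)
  have hneg := ha (-f i)
  rw [map_neg, norm_neg] at hneg
  rw [hv.1 i, mul_one] at hpos hneg
  exact ⟨neg_le.1 hneg, hpos⟩

theorem ae_sub_notMem (hμ : ∫ x, x ∂μ = 0)
    (hinf : ¬ FiniteDimensional ℝ (CameronMartinSpace μ))
    (V : Submodule ℝ B) [FiniteDimensional ℝ V] (b : B) : ∀ᵐ x ∂μ, x - b ∉ V := by
  obtain ⟨f, hfV, hf⟩ := exists_strongDual_eq_zero_on_mk_ne_zero hinf V
  filter_upwards [ae_dual_ne hμ hf (f b)] with x hx hxV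
  exact hx (sub_eq_zero.1 (by rw [← map_sub, hfV _ hxV]))

theorem nontrivial_of_ne_dirac (hμ : ∫ x, x ∂μ = 0) (hd : μ ≠ Measure.dirac 0) :
    Nontrivial (CameronMartinSpace μ) := by
  by_contra! htriv
  refine hd (hμ ▸ IsGaussian.eq_dirac_of_variance_eq_zero fun f => ?_)
  rw [variance_dual hμ, ← UniformSpace.Completion.norm_coe,
    Subsingleton.elim (mk μ f : CameronMartinSpace μ) 0, norm_zero, zero_pow two_ne_zero]

theorem exists_mul_norm_mk_lt_dual_toBanach [Nontrivial (CameronMartinSpace μ)]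
    {h : CameronMartinSpace μ} {r : ℝ} (hr : r < ‖h‖) :
    ∃ f : StrongDual ℝ B, r * ‖mk μ f‖ < f (toBanach μ h) := by
  obtain ⟨y, hy⟩ : ∃ y : CameronMartinSpace μ, r * ‖y‖ < inner ℝ y h := by
    rcases eq_or_ne h 0 with rfl | hh
    · obtain ⟨y, hy⟩ := exists_ne (0 : CameronMartinSpace μ)
      rw [norm_zero] at hr
      exact ⟨y, by simpa using mul_neg_of_neg_of_pos hr (norm_pos_iff.2 hy)⟩
    · refine ⟨h, ?_⟩
      rw [real_inner_self_eq_norm_mul_norm]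
      gcongr
  obtain ⟨f, hf⟩ := denseRange_mk.exists_mem_open
    (isOpen_lt (f := fun y : CameronMartinSpace μ => r * ‖y‖) (g := fun y => inner ℝ y h)
      (by fun_prop) (by fun_prop)) ⟨y, hy⟩
  refine ⟨f, ?_⟩
  rw [dual_toBanach, ← UniformSpace.Completion.norm_coe (mk μ f)]
  exact hf

end CameronMartinSpace

open CameronMartin CameronMartinSpace

theorem tukeyDepth_le_of_lt_dual (hμ : ∫ x, x ∂μ = 0) {a : B} {r : ℝ} {f : StrongDual ℝ B}
    (h : r * ‖mk μ f‖ < f a) : tukeyDepth a μ ≤ 1 - stdNormalCdf r :=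
  (tukeyDepth_le_measureReal f a μ).trans (measureReal_halfSpace_le hμ h)

theorem le_tukeyDepth_toBanach (hμ : ∫ x, x ∂μ = 0) (h : CameronMartinSpace μ) :
    1 - stdNormalCdf ‖h‖ ≤ tukeyDepth (toBanach μ h) μ :=
  le_tukeyDepth fun f => le_measureReal_halfSpace hμ (dual_toBanach_le f h)

theorem tukeyDepth_toBanach_pos (hμ : ∫ x, x ∂μ = 0) (h : CameronMartinSpace μ) :
    0 < tukeyDepth (toBanach μ h) μ :=
  (sub_pos.2 (stdNormalCdf_lt_one _)).trans_le (le_tukeyDepth_toBanach hμ h)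

theorem tukeyDepth_toBanach (hμ : ∫ x, x ∂μ = 0) [Nontrivial (CameronMartinSpace μ)]
    (h : CameronMartinSpace μ) : tukeyDepth (toBanach μ h) μ = 1 - stdNormalCdf ‖h‖ := by
  refine le_antisymm ?_ (le_tukeyDepth_toBanach hμ h)
  have hlim : Tendsto (fun r => 1 - stdNormalCdf r) (𝓝[<] ‖h‖) (𝓝 (1 - stdNormalCdf ‖h‖)) :=
    (continuous_const.sub continuous_stdNormalCdf).continuousWithinAt
  refine ge_of_tendsto hlim (eventually_mem_nhdsWithin.mono fun r hr => ?_)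
  obtain ⟨f, hf⟩ := exists_mul_norm_mk_lt_dual_toBanach hr
  exact tukeyDepth_le_of_lt_dual hμ hf

theorem tukeyDepth_eq_zero_of_notMem_range (hμ : ∫ x, x ∂μ = 0) {a : B}
    (ha : a ∉ Set.range (toBanach μ)) : tukeyDepth a μ = 0 := by
  have hbound (n : ℕ) : tukeyDepth a μ ≤ 1 - stdNormalCdf n := by
    rw [range_toBanach, Set.mem_iUnion, not_exists] at ha
    obtain ⟨f, hf⟩ := not_forall.1 (ha n)
    exact tukeyDepth_le_of_lt_dual hμ (not_le.1 hf)
  have hlim : Tendsto (fun n : ℕ => 1 - stdNormalCdf n) atTop (𝓝 0) := by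
    simpa using (tendsto_stdNormalCdf_atTop.comp tendsto_natCast_atTop_atTop).const_sub 1
  exact (ge_of_tendsto' hlim hbound).antisymm (tukeyDepth_nonneg a μ)

theorem setOf_tukeyDepth_eq_zero (hμ : ∫ x, x ∂μ = 0) :
    {a : B | tukeyDepth a μ = 0} = (Set.range (toBanach μ))ᶜ := by
  refine Set.Subset.antisymm ?_ fun a => tukeyDepth_eq_zero_of_notMem_range hμ
  rintro _ ha ⟨h, rfl⟩
  exact (tukeyDepth_toBanach_pos hμ h).ne' ha

theorem ae_tukeyDepth_empiricalMeasure_eq_zero (hμ : ∫ x, x ∂μ = 0)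
    (hinf : ¬ FiniteDimensional ℝ (CameronMartinSpace μ))
    {Ω : Type*} [MeasurableSpace Ω] {P : Measure Ω} [IsProbabilityMeasure P] {X : ℕ → Ω → B}
    (hX : ∀ j, Measurable (X j)) (hlaw : ∀ j, P.map (X j) = μ) (hind : iIndepFun X P) (b : B) :
    ∀ᵐ ω ∂P, ∀ n, tukeyDepth b (empiricalMeasure X n ω) = 0 := by
  refine ae_all_iff.2 fun n => ?_
  have hsub : iIndepFun (fun (i : Fin n) ω => X i ω - b) P :=
    (hind.precomp Fin.val_injective).comp (fun _ x => x - b) fun _ => measurable_id.sub_const b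
  have hnull (i : Fin n) (V : Submodule ℝ B) (_ : FiniteDimensional ℝ V) :
      ∀ᵐ ω ∂P, X i ω - b ∉ V :=
    ae_of_ae_map (hX i).aemeasurable (by rw [hlaw]; exact ae_sub_notMem hμ hinf V b)
  filter_upwards [ae_linearIndependent_of_iIndepFun (fun i => (hX i).sub_const b) hsub hnull]
    with ω hω
  exact tukeyDepth_empiricalMeasure_eq_zero hω

end Gaussian

theorem proposition2 {B : Type*} [NormedAddCommGroup B] [NormedSpace ℝ B] [CompleteSpace B]
    [SecondCountableTopology B] [MeasurableSpace B] [BorelSpace B]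
    (μ : Measure B) [IsGaussian μ] (hcentered : ∫ x, x ∂μ = 0) :
    -- the depth on `H_μ`, for `μ` not the point mass at the origin
    (μ ≠ Measure.dirac 0 → ∀ h : CameronMartinSpace μ,
      tukeyDepth (CameronMartinSpace.toBanach μ h) μ = 1 - stdNormalCdf ‖h‖) ∧
    -- the depth off `H_μ`
    (∀ a : B, a ∉ Set.range (CameronMartinSpace.toBanach μ) → tukeyDepth a μ = 0) ∧
    -- the zero-one law for the set of points of depth zero
    MeasurableSet {a : B | tukeyDepth a μ = 0} ∧
    (FiniteDimensional ℝ (CameronMartinSpace μ) → μ {a : B | tukeyDepth a μ = 0} = 0) ∧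
    (¬ FiniteDimensional ℝ (CameronMartinSpace μ) → μ {a : B | tukeyDepth a μ = 0} = 1) ∧
    -- the empirical depth and the failure of consistency
    (¬ FiniteDimensional ℝ (CameronMartinSpace μ) →
      ∀ (Ω : Type*) [MeasurableSpace Ω] (P : Measure Ω) [IsProbabilityMeasure P]
        (X : ℕ → Ω → B), (∀ j, Measurable (X j)) → (∀ j, P.map (X j) = μ) → iIndepFun X P →
        ∀ h : CameronMartinSpace μ,
          (∀ᵐ ω ∂P, ∀ n : ℕ, 1 ≤ n →
            tukeyDepth (CameronMartinSpace.toBanach μ h) (empiricalMeasure X n ω) = 0) ∧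
          0 < tukeyDepth (CameronMartinSpace.toBanach μ h) μ ∧
          (∀ᵐ ω ∂P, ¬ Tendsto
            (fun n : ℕ =>
              tukeyDepth (CameronMartinSpace.toBanach μ h) (empiricalMeasure X n ω))
            atTop (𝓝 (tukeyDepth (CameronMartinSpace.toBanach μ h) μ)))) := by
  have hset := setOf_tukeyDepth_eq_zero hcentered
  have hmeas := CameronMartinSpace.measurableSet_range_toBanach (μ := μ)
  refine ⟨fun hd h => ?_, fun a => tukeyDepth_eq_zero_of_notMem_range hcentered,
    hset ▸ hmeas.compl, fun hfin => ?_, fun hinf => ?_, fun hinf Ω _ P _ X hX hlaw hind h => ?_⟩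
  · have := CameronMartinSpace.nontrivial_of_ne_dirac hcentered hd
    exact tukeyDepth_toBanach hcentered h
  · rw [hset]
    exact CameronMartinSpace.ae_mem_range_toBanach
  · rw [hset, prob_compl_eq_one_iff hmeas]
    exact CameronMartinSpace.measure_range_toBanach_eq_zero hcentered hinf
  · have hpos := tukeyDepth_toBanach_pos hcentered h
    have hzero := ae_tukeyDepth_empiricalMeasure_eq_zero hcentered hinf hX hlaw hind
      (CameronMartinSpace.toBanach μ h)
    refine ⟨hzero.mono fun ω hω n _ => hω n, hpos, hzero.mono fun ω hω hlim => hpos.ne ?_⟩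
    simp only [hω] at hlim
    exact tendsto_nhds_unique tendsto_const_nhds hlim
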